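/- Use the Fourier transform $\hat f(\xi)=\int_{\mathbb R} f(t)e^{-2\pi i\xi t}\,dt$, extended to $L^2(\mathbb R)$. A function $f\in L^2(\mathbb R)$ is called bandlimited to $\Omega>0$ rad/s if $\hat f(\xi)=0$ for almost every $\xi$ with $|\xi|\ge \Omega/2\pi$, and bandlimited if this holds for some $\Omega>0$. An entire function $F$ is of exponential type if there are constants $M,\tau>0$ with $|F(z)|\le Me^{\tau|z|}$ for all $z\in\mathbb C$; the infimum of all such $\tau$ is called its type. Let $f:\mathbb R\to\mathbb C$ be a continuous, square-integrable, bandlimited function that is not identically zero, and suppose that $f(n)\in\mathbb Z$ for every integer $n\ge 0$. Then $f$ extends to an entire function; this (unique) extension is of exponential type, and its type $\sigma$ satisfies $\sigma\ge 0.8$. Moreover, such an $f$ is not bandlimited to $0.8$ rad/s, that is, its spectrum is not confined to the interval $(-0.8,0.8)$ rad/s. -/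

import Mathlib

open MeasureTheory FourierTransform

/-- `f : ℝ → ℂ` is square integrable and its `L²` Fourier transform, normalised as
`∫ f(t) exp(-2πiξt) dt`, vanishes for (almost) all `|ξ| ≥ Ω / 2π`, i.e. `f` is bandlimited to
`Ω` rad/s, where `Ω > 0`. -/
def IsBandlimitedTo (Ω : ℝ) (f : ℝ → ℂ) : Prop :=
  0 < Ω ∧ ∃ hf : MemLp f 2 (volume : Measure ℝ),
    ∀ᵐ ξ : ℝ, Ω / (2 * Real.pi) ≤ |ξ| → (𝓕 (hf.toLp f) : Lp ℂ 2 (volume : Measure ℝ)) ξ = 0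

/-- `f` is bandlimited: it is bandlimited to some `Ω > 0`. -/
def IsBandlimited (f : ℝ → ℂ) : Prop :=
  ∃ Ω : ℝ, IsBandlimitedTo Ω f

/-- `F` is an entire function that agrees with `f` on the real line. -/
def IsEntireExtension (f : ℝ → ℂ) (F : ℂ → ℂ) : Prop :=
  Differentiable ℂ F ∧ ∀ t : ℝ, F (t : ℂ) = f t

/-- The exponents `τ > 0` for which `|F(z)| ≤ M exp(τ|z|)` on `ℂ` with some constant `M > 0`. -/
def growthExponents (F : ℂ → ℂ) : Set ℝ :=
  {τ : ℝ | 0 < τ ∧ ∃ M : ℝ, 0 < M ∧ ∀ z : ℂ, ‖F z‖ ≤ M * Real.exp (τ * ‖z‖)}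

/-- `F` is of exponential type (used for entire `F`). -/
def IsOfExponentialType (F : ℂ → ℂ) : Prop :=
  (growthExponents F).Nonempty

/-- The exponential type of `F`, the infimum of the admissible exponents; meaningful when
`IsOfExponentialType F` (the set is bounded below by `0`). -/
noncomputable def exponentialType (F : ℂ → ℂ) : ℝ :=
  sInf (growthExponents F)

open Filter Topology

/-! The spectrum of f is integrable, so f is its inverse Fourier integral. By Riemann–Lebesgue f
vanishes at infinity, and the integral at complex arguments is an entire extension of exponential
type. Integers tending to 0 are eventually 0, so the extension F vanishes at all integers from some
N on. If F had a growth exponent τ < 1, a Jensen bound on the disc of radius n about any t in (m,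
m+1), m ≥ N, would give |F(t)| ≤ C e^{τn} n!/n^n, which tends to 0 by Stirling; so F = 0
(`eq_zero_of_growth_lt_one_of_zeros`). Hence every growth exponent is at least 1, more than the 0.8
required. -/

/-- On integrable square-integrable functions, the `L²` inverse Fourier transform is given by the
Fourier inversion integral. -/
theorem Lp_fourierInv_ae_eq (g : Lp ℂ 2 (volume : Measure ℝ)) (hg : Integrable (g : ℝ → ℂ)) :
    ((𝓕⁻ g : Lp ℂ 2 (volume : Measure ℝ)) : ℝ → ℂ) =ᵐ[volume] 𝓕⁻ (g : ℝ → ℂ) := by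
  have hcont : Continuous (𝓕⁻ (g : ℝ → ℂ)) :=
    VectorFourier.fourierIntegral_continuous (L := -innerₗ ℝ) Real.continuous_fourierChar
      (by simp only [LinearMap.neg_apply, innerₗ_apply_apply]; fun_prop) hg
  refine ae_eq_of_integral_contDiff_smul_eq
    ((Lp.memLp _).locallyIntegrable (by norm_num)) hcont.locallyIntegrable ?_
  intro φ hφ hs
  have hs' : HasCompactSupport (fun x => (φ x : ℂ)) := hs.comp_left (g := fun x : ℝ => (x : ℂ)) rfl
  have hφ' : ContDiff ℝ (⊤ : ℕ∞) (fun x => (φ x : ℂ)) := Complex.ofRealCLM.contDiff.comp hφ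
  set ψ : SchwartzMap ℝ ℂ := hs'.toSchwartzMap hφ' with hψ
  have hψx : ∀ x, ψ x = (φ x : ℂ) := fun x => rfl
  have h1 := DFunLike.congr_fun (Lp.fourierInv_toTemperedDistribution_eq g) ψ
  rw [TemperedDistribution.fourierInv_apply, Lp.toTemperedDistribution_apply,
    Lp.toTemperedDistribution_apply] at h1
  -- Fubini moves the transform from the test function onto g; the kernel is symmetric, so the
  -- flipped pairing is the same one.
  have h2 := VectorFourier.integral_fourierIntegral_smul_eq_flip (L := -innerₗ ℝ)
    (μ := volume) (ν := volume) Real.continuous_fourierChar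
      (by simp only [LinearMap.neg_apply, innerₗ_apply_apply]; fun_prop)
      (ψ.integrable (μ := volume)) hg
  have hflip : (-innerₗ ℝ : ℝ →ₗ[ℝ] ℝ →ₗ[ℝ] ℝ).flip = -innerₗ ℝ := by
    ext; simp
  rw [hflip] at h2
  have h3 : ∀ x, (𝓕⁻ ψ) x = VectorFourier.fourierIntegral Real.fourierChar volume (-innerₗ ℝ) ψ x := by
    intro x
    rw [SchwartzMap.fourierInv_coe]
    rfl
  simp_rw [h3] at h1
  rw [h2] at h1
  simp_rw [hψx] at h1
  simp only [Complex.real_smul]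
  exact h1.symm

/-- A square-integrable function supported in a bounded interval, up to a null set, is integrable. -/
theorem integrable_of_memLp_two_of_ae_eq_zero {g : ℝ → ℂ} (hg : MemLp g 2 volume) {A : ℝ}
    (h0 : ∀ᵐ ξ : ℝ, A ≤ |ξ| → g ξ = 0) : Integrable g := by
  have h : IntegrableOn g (Set.Icc (-A) A) := by
    have : IsFiniteMeasure (volume.restrict (Set.Icc (-A) A)) := ⟨by simp⟩
    exact (hg.restrict _).integrable (by norm_num)
  refine (h.integrable_indicator measurableSet_Icc).congr ?_
  filter_upwards [h0] with ξ hξ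
  by_cases hm : ξ ∈ Set.Icc (-A) A
  · simp [hm]
  · rw [Set.indicator_of_notMem hm, hξ]
    by_contra! hlt
    exact hm ⟨(abs_lt.1 hlt).1.le, (abs_lt.1 hlt).2.le⟩

/-- The Fourier–Laplace transform of an integrable function supported in `[-A, A]` is entire and of
exponential type at most `2πA`. -/
theorem fourierLaplace_entire {g : ℝ → ℂ} (hg : Integrable g) {A : ℝ}
    (h0 : ∀ᵐ ξ : ℝ, A ≤ |ξ| → g ξ = 0) :
    Differentiable ℂ (fun z : ℂ => ∫ ξ : ℝ, Complex.exp (2 * Real.pi * ξ * Complex.I * z) * g ξ) ∧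
    ∀ z : ℂ, ‖∫ ξ : ℝ, Complex.exp (2 * Real.pi * ξ * Complex.I * z) * g ξ‖ ≤
      (∫ ξ, ‖g ξ‖) * Real.exp (2 * Real.pi * A * ‖z‖) := by
  have hexp : ∀ (r : ℝ) (z : ℂ) (ξ : ℝ), ‖z‖ ≤ r → |ξ| ≤ A →
      ‖Complex.exp (2 * Real.pi * ξ * Complex.I * z)‖ ≤ Real.exp (2 * Real.pi * A * r) := by
    intro r z ξ hz hξ
    refine (Complex.norm_exp_le_exp_norm _).trans (Real.exp_le_exp.2 ?_)
    have : ‖(2 * Real.pi * ξ * Complex.I * z : ℂ)‖ = 2 * Real.pi * |ξ| * ‖z‖ := by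
      simp [abs_of_pos Real.pi_pos]
    rw [this]
    have := Real.pi_pos
    have := (abs_nonneg ξ).trans hξ
    gcongr
  have hmeas : ∀ z : ℂ, AEStronglyMeasurable
      (fun ξ : ℝ => Complex.exp (2 * Real.pi * ξ * Complex.I * z) * g ξ) volume := fun z =>
    (Continuous.aestronglyMeasurable (by fun_prop)).mul hg.1
  have hbd : ∀ (r : ℝ), ∀ᵐ ξ : ℝ, ∀ z : ℂ, ‖z‖ ≤ r →
      ‖Complex.exp (2 * Real.pi * ξ * Complex.I * z) * g ξ‖ ≤
        Real.exp (2 * Real.pi * A * r) * ‖g ξ‖ := by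
    intro r
    filter_upwards [h0] with ξ hξ z hz
    by_cases hA : A ≤ |ξ|
    · simp [hξ hA]
    · rw [norm_mul]
      gcongr
      exact hexp r z ξ hz (not_le.1 hA).le
  constructor
  · intro z₀
    refine (hasDerivAt_integral_of_dominated_loc_of_deriv_le (𝕜 := ℂ) (μ := volume)
      (F := fun (z : ℂ) (ξ : ℝ) => Complex.exp (2 * Real.pi * ξ * Complex.I * z) * g ξ)
      (F' := fun (z : ℂ) (ξ : ℝ) => (2 * Real.pi * ξ * Complex.I) *
        (Complex.exp (2 * Real.pi * ξ * Complex.I * z) * g ξ))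
      (bound := fun ξ => 2 * Real.pi * A * (Real.exp (2 * Real.pi * A * (‖z₀‖ + 1)) * ‖g ξ‖))
      (Metric.ball_mem_nhds z₀ one_pos) (Eventually.of_forall hmeas) ?_ ?_ ?_ ?_ ?_).2.differentiableAt
    · refine (hg.norm.const_mul (Real.exp (2 * Real.pi * A * ‖z₀‖))).mono' (hmeas z₀) ?_
      filter_upwards [hbd ‖z₀‖] with ξ hξ using hξ z₀ le_rfl
    · exact (Continuous.aestronglyMeasurable (by fun_prop)).mul (hmeas z₀)
    · filter_upwards [hbd (‖z₀‖ + 1), h0] with ξ hξ hξ0 z hz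
      by_cases hA : A ≤ |ξ|
      · simp [hξ0 hA]
      · have hz' : ‖z‖ ≤ ‖z₀‖ + 1 := by
          have h1 : ‖z - z₀‖ < 1 := by simpa [dist_eq_norm] using hz
          have h2 := norm_le_norm_add_norm_sub' z z₀
          linarith
        rw [norm_mul]
        have hn : ‖(2 * Real.pi * ξ * Complex.I : ℂ)‖ = 2 * Real.pi * |ξ| := by
          simp [abs_of_pos Real.pi_pos]
        rw [hn]
        have := Real.pi_pos
        gcongr
        · have := abs_nonneg ξ
          nlinarith [not_le.1 hA]
        · exact (not_le.1 hA).le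
        · exact hξ z hz'
    · exact (hg.norm.const_mul _).const_mul _
    · refine Eventually.of_forall fun ξ z _ => ?_
      have h1 : HasDerivAt (fun z : ℂ => 2 * Real.pi * ξ * Complex.I * z)
          (2 * Real.pi * ξ * Complex.I) z := by
        simpa using (hasDerivAt_id z).const_mul (2 * Real.pi * ξ * Complex.I : ℂ)
      exact (h1.cexp.mul_const (g ξ)).congr_deriv (by ring)
  · intro z
    rw [mul_comm (∫ ξ, ‖g ξ‖), ← integral_const_mul]
    refine norm_integral_le_of_norm_le (hg.norm.const_mul _) ?_
    filter_upwards [hbd ‖z‖] with ξ hξ using hξ z le_rfl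

/-- The easy direction of the Paley–Wiener theorem, together with the Riemann–Lebesgue lemma. -/
theorem IsBandlimitedTo.exists_entire_extension {f : ℝ → ℂ} {Ω : ℝ} (h : IsBandlimitedTo Ω f)
    (hcont : Continuous f) :
    Tendsto f (cocompact ℝ) (𝓝 0) ∧
      ∃ F : ℂ → ℂ, IsEntireExtension f F ∧ Ω ∈ growthExponents F := by
  obtain ⟨hΩ, hf, h0⟩ := h
  set g : Lp ℂ 2 (volume : Measure ℝ) := 𝓕 (hf.toLp f) with hgdef
  have hg : Integrable (g : ℝ → ℂ) := integrable_of_memLp_two_of_ae_eq_zero (Lp.memLp g) h0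
  have hinv : 𝓕⁻ g = hf.toLp f := FourierTransform.fourierInv_fourier_eq _
  have hae : f =ᵐ[volume] 𝓕⁻ (g : ℝ → ℂ) := by
    have := Lp_fourierInv_ae_eq g hg
    rw [hinv] at this
    exact hf.coeFn_toLp.symm.trans this
  have hcont' : Continuous (𝓕⁻ (g : ℝ → ℂ)) :=
    VectorFourier.fourierIntegral_continuous (L := -innerₗ ℝ) Real.continuous_fourierChar
      (by simp only [LinearMap.neg_apply, innerₗ_apply_apply]; fun_prop) hg
  have hfeq : f = 𝓕⁻ (g : ℝ → ℂ) := (hcont.ae_eq_iff_eq volume hcont').1 hae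
  constructor
  · rw [hfeq, Real.fourierInv_eq_fourier_comp_neg]
    exact Real.zero_at_infty_fourier _
  · obtain ⟨hd, hb⟩ := fourierLaplace_entire hg h0
    refine ⟨_, ⟨hd, ?_⟩, hΩ, (∫ ξ, ‖g ξ‖) + 1, ?_, ?_⟩
    · intro t
      conv_rhs => rw [hfeq]
      rw [Real.fourierInv_eq']
      refine integral_congr_ae (Eventually.of_forall fun ξ => ?_)
      simp only [smul_eq_mul, RCLike.inner_apply, conj_trivial]
      push_cast
      congr 2
      ring
    · have : 0 ≤ ∫ ξ, ‖g ξ‖ := integral_nonneg fun _ => norm_nonneg _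
      linarith
    · intro z
      refine (hb z).trans ?_
      have : 2 * Real.pi * (Ω / (2 * Real.pi)) = Ω := by field_simp
      rw [this]
      gcongr
      linarith

/-! ### Zeros on the positive axis and Jensen's bound -/

/-- Division of an entire function by the Blaschke factor of a real zero `a` in the disc of
radius `R`. -/
theorem exists_entire_div_blaschke {g : ℂ → ℂ} (hg : Differentiable ℂ g) {R M a : ℝ}
    (hR : 0 < R) (hM : ∀ z : ℂ, ‖z‖ = R → ‖g z‖ ≤ M) (hMnn : 0 ≤ M) (ha : 0 < a) (hga : g a = 0) :
    ∃ h : ℂ → ℂ, Differentiable ℂ h ∧ (∀ z : ℂ, ‖z‖ = R → ‖h z‖ ≤ M) ∧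
      ‖g 0‖ = ‖h 0‖ * (a / R) ∧ ∀ b : ℂ, b ≠ a → g b = 0 → h b = 0 := by
  have hds : ∀ z : ℂ, z ≠ a → (z - a) * dslope g a z = g z := by
    intro z _
    have := sub_smul_dslope g (a : ℂ) z
    rwa [hga, sub_zero, smul_eq_mul] at this
  have haC : (a : ℂ) ≠ 0 := by exact_mod_cast ha.ne'
  have hRC : (R : ℂ) ≠ 0 := by exact_mod_cast hR.ne'
  -- The inverse Blaschke factor (R² - az) / (R(z - a)) has modulus 1 on |z| = R away from a;
  -- `dslope` supplies g/(z - a) without the singularity.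
  refine ⟨fun z => dslope g a z * ((R ^ 2 - a * z) / R), ?_, ?_, ?_, ?_⟩
  · have h1 : Differentiable ℂ (dslope g (a : ℂ)) := by
      rw [← differentiableOn_univ]
      exact (Complex.differentiableOn_dslope univ_mem).2 hg.differentiableOn
    fun_prop
  · intro z hz
    -- A zero on the circle itself forces a = R, and then R² - az vanishes there.
    by_cases hza : z = a
    · have haR' : a = R := by
        rw [← hz, hza, Complex.norm_real, Real.norm_of_nonneg ha.le]
      have : (R : ℂ) ^ 2 - a * z = 0 := by rw [hza, haR']; ring
      simpa [this] using hMnn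
    · have hnorm : ‖(R : ℂ) ^ 2 - a * z‖ = R * ‖z - a‖ := by
        have h1 : (R : ℂ) ^ 2 - a * z = z * (starRingEnd ℂ) (z - a) := by
          have : z * (starRingEnd ℂ) z = (R : ℂ) ^ 2 := by rw [Complex.mul_conj']; rw [hz]
          rw [map_sub, mul_sub, this, Complex.conj_ofReal]; ring
        rw [h1, norm_mul, Complex.norm_conj, hz]
      have hne : ‖z - a‖ ≠ 0 := norm_ne_zero_iff.2 (sub_ne_zero.2 hza)
      refine le_of_eq_of_le ?_ (hM z hz)
      rw [norm_mul, norm_div, hnorm, ← hds z hza, norm_mul, Complex.norm_real,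
        Real.norm_of_nonneg hR.le]
      field_simp
  · have h0 := hds 0 (by simpa using haC.symm)
    have : g 0 = -((dslope g a 0 * ((R ^ 2 - a * 0) / R)) * (a / R)) := by
      rw [← h0]; field_simp; ring
    rw [this, norm_neg, norm_mul]
    congr 1
    rw [norm_div, Complex.norm_real, Complex.norm_real, Real.norm_of_nonneg ha.le,
      Real.norm_of_nonneg hR.le]
  · intro b hb hgb
    have := hds b hb
    rw [hgb] at this
    simp [(mul_eq_zero.1 this).resolve_left (sub_ne_zero.2 hb)]

/-- A Jensen-type bound: zeros of an entire function in a disc make it small at the centre. -/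
theorem norm_le_mul_prod_of_zeros {R M : ℝ} (hR : 0 < R) (hMnn : 0 ≤ M) (s : Finset ℕ)
    (a : ℕ → ℝ) (hinj : Set.InjOn a s) (ha : ∀ k ∈ s, 0 < a k ∧ a k ≤ R) {g : ℂ → ℂ}
    (hg : Differentiable ℂ g) (hM : ∀ z : ℂ, ‖z‖ = R → ‖g z‖ ≤ M)
    (hz : ∀ k ∈ s, g (a k) = 0) : ‖g 0‖ ≤ M * ∏ k ∈ s, (a k / R) := by
  induction s using Finset.induction_on generalizing g with
  | empty =>
    rw [Finset.prod_empty, mul_one]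
    refine Complex.norm_le_of_forall_mem_frontier_norm_le (U := Metric.ball (0 : ℂ) R)
      Metric.isBounded_ball hg.diffContOnCl ?_ (subset_closure (Metric.mem_ball_self hR))
    intro z hzf
    rw [frontier_ball _ hR.ne'] at hzf
    exact hM z (by simpa using hzf)
  | insert k s hk ih =>
    obtain ⟨hk0, -⟩ := ha k (Finset.mem_insert_self _ _)
    obtain ⟨h, hd, hb, heq, hzero⟩ := exists_entire_div_blaschke hg hR hM hMnn hk0
      (hz k (Finset.mem_insert_self _ _))
    have := ih (hinj.mono (by simp)) (fun j hj => ha j (Finset.mem_insert_of_mem hj)) hd hb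
      (fun j hj => hzero _ ?_ (hz j (Finset.mem_insert_of_mem hj)))
    · rw [heq, Finset.prod_insert hk]
      calc ‖h 0‖ * (a k / R) ≤ (M * ∏ k ∈ s, (a k / R)) * (a k / R) := by gcongr
        _ = _ := by ring
    · intro he
      have := hinj (Finset.mem_coe.2 (Finset.mem_insert_of_mem hj))
        (Finset.mem_coe.2 (Finset.mem_insert_self _ _)) (Complex.ofReal_injective he)
      exact hk (this ▸ hj)

/-- By Stirling n!/n^n is √(2n) e^{-n} times a sequence converging to √π, and e^{-(1-τ)n} beats √n.
-/
theorem tendsto_exp_mul_factorial_div_pow {τ : ℝ} (hτ : τ < 1) :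
    Tendsto (fun n : ℕ => Real.exp (τ * n) * ((n.factorial : ℝ) / (n : ℝ) ^ n)) atTop (𝓝 0) := by
  have h1 : Tendsto (fun n : ℕ => √(2 * n : ℝ) * Real.exp (-(1 - τ) * n)) atTop (𝓝 0) := by
    have h := (tendsto_rpow_mul_exp_neg_mul_atTop_nhds_zero (1 / 2) (1 - τ) (by linarith)).comp
      tendsto_natCast_atTop_atTop
    have h' := h.const_mul (√2)
    rw [mul_zero] at h'
    refine h'.congr fun n => ?_
    simp only [Function.comp_apply]
    rw [Real.sqrt_mul (by norm_num), ← Real.sqrt_eq_rpow, mul_assoc]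
  have h2 := Stirling.tendsto_stirlingSeq_sqrt_pi.mul h1
  rw [mul_zero] at h2
  refine h2.congr' ?_
  filter_upwards [eventually_gt_atTop 0] with n hn
  have hn' : (0 : ℝ) < n := by exact_mod_cast hn
  have he : Real.exp (-(1 - τ) * n) = Real.exp (τ * n) / Real.exp 1 ^ n := by
    rw [← Real.exp_nat_mul, ← Real.exp_sub]; congr 1; ring
  have hs : √(2 * n : ℝ) ≠ 0 := by positivity
  rw [Stirling.stirlingSeq, he, div_pow]
  field_simp

/-- An entire function of exponential type less than one which vanishes at all large integers is
zero. -/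
theorem eq_zero_of_growth_lt_one_of_zeros {F : ℂ → ℂ} (hF : Differentiable ℂ F) {τ : ℝ}
    (hτ : τ ∈ growthExponents F) (hτ1 : τ < 1) {N : ℕ} (hN : ∀ n : ℕ, N ≤ n → F n = 0) :
    F = 0 := by
  obtain ⟨hτ0, M, hM0, hM⟩ := hτ
  have key : ∀ m : ℕ, N ≤ m → ∀ t : ℝ, (m : ℝ) < t → t < m + 1 → F t = 0 := by
    intro m hm t hmt htm
    have hbound : ∀ n : ℕ, 0 < n → ‖F t‖ ≤
        M * Real.exp (τ * |t|) * (Real.exp (τ * n) * ((n.factorial : ℝ) / (n : ℝ) ^ n)) := by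
      intro n hn
      have hn' : (0 : ℝ) < n := by exact_mod_cast hn
      have hmem : ∀ k ∈ Finset.range n, 0 < (m : ℝ) + k + 1 - t ∧ (m : ℝ) + k + 1 - t ≤ k + 1 :=
        fun k _ => ⟨by have : (0 : ℝ) ≤ k := k.cast_nonneg
                       linarith, by linarith⟩
      -- With the centre moved to t, the zeros m+1, …, m+n lie at distances at most 1, …, n, hence
      -- in the disc of radius n.
      have h := norm_le_mul_prod_of_zeros (R := n) (M := M * Real.exp (τ * (|t| + n))) hn'
        (by positivity) (Finset.range n) (fun k => (m : ℝ) + k + 1 - t)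
        (fun i _ j _ hij => by
          have : (i : ℝ) = j := by simpa using hij
          exact_mod_cast this)
        (fun k hk => ⟨(hmem k hk).1, (hmem k hk).2.trans (by
          exact_mod_cast Finset.mem_range.1 hk)⟩)
        (g := fun z => F (t + z)) (by fun_prop)
        (fun z hz => (hM _).trans (by
          have : ‖(t : ℂ) + z‖ ≤ |t| + n := by
            refine (norm_add_le _ _).trans ?_
            rw [hz, Complex.norm_real, Real.norm_eq_abs]
          gcongr))
        (fun k _ => by
          have := hN (m + k + 1) (by omega)
          rw [← this]
          congr 1
          push_cast
          ring)
      simp only [add_zero] at h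
      refine h.trans ?_
      have hprod : ∏ k ∈ Finset.range n, (((m : ℝ) + k + 1 - t) / n) ≤
          (n.factorial : ℝ) / (n : ℝ) ^ n := by
        calc _ ≤ ∏ k ∈ Finset.range n, (((k : ℝ) + 1) / n) := by
              refine Finset.prod_le_prod (fun k hk => ?_) (fun k hk => ?_)
              · exact div_nonneg (hmem k hk).1.le hn'.le
              · exact div_le_div_of_nonneg_right (hmem k hk).2 hn'.le
          _ = _ := by
              rw [Finset.prod_div_distrib, Finset.prod_const, Finset.card_range,
                ← Finset.prod_range_add_one_eq_factorial]
              push_cast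
              rfl
      calc _ ≤ M * Real.exp (τ * (|t| + n)) * ((n.factorial : ℝ) / (n : ℝ) ^ n) := by gcongr
        _ = _ := by rw [mul_add, Real.exp_add]; ring
    have hlim := (tendsto_exp_mul_factorial_div_pow hτ1).const_mul (M * Real.exp (τ * |t|))
    rw [mul_zero] at hlim
    have : ‖F t‖ ≤ 0 := ge_of_tendsto hlim
      ((eventually_gt_atTop 0).mono fun n hn => hbound n hn)
    exact norm_le_zero_iff.1 this
  -- Vanishing on the real interval (N, N+1) is enough for the identity theorem at its midpoint.
  have hev : ∃ᶠ z in 𝓝[≠] (((N : ℝ) + 1 / 2 : ℝ) : ℂ), F z = 0 := by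
    have hne : Tendsto (fun t : ℝ => (t : ℂ)) (𝓝[≠] ((N : ℝ) + 1 / 2))
        (𝓝[≠] (((N : ℝ) + 1 / 2 : ℝ) : ℂ)) :=
      tendsto_nhdsWithin_of_tendsto_nhds_of_eventually_within _
        ((Complex.continuous_ofReal.tendsto _).mono_left nhdsWithin_le_nhds)
        (eventually_mem_nhdsWithin.mono fun t ht h => ht (Complex.ofReal_injective h))
    refine hne.frequently (Eventually.frequently ?_)
    refine nhdsWithin_le_nhds ?_
    filter_upwards [Ioo_mem_nhds (show (N : ℝ) < N + 1 / 2 by linarith)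
      (show (N : ℝ) + 1 / 2 < N + 1 by linarith)] with t ht
    exact key N le_rfl t ht.1 ht.2
  have hA : AnalyticOnNhd ℂ F Set.univ := hF.differentiableOn.analyticOnNhd isOpen_univ
  funext z
  exact hA.eqOn_zero_of_preconnected_of_frequently_eq_zero isPreconnected_univ (Set.mem_univ _) hev
    (Set.mem_univ z)

/-- The real axis accumulates at 0. This carries the growth bound of the Fourier–Laplace extension
over to any other. -/
theorem IsEntireExtension.unique {f : ℝ → ℂ} {F G : ℂ → ℂ} (hF : IsEntireExtension f F)
    (hG : IsEntireExtension f G) : F = G := by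
  have hA : AnalyticOnNhd ℂ F Set.univ := hF.1.differentiableOn.analyticOnNhd isOpen_univ
  have hB : AnalyticOnNhd ℂ G Set.univ := hG.1.differentiableOn.analyticOnNhd isOpen_univ
  refine hA.eq_of_frequently_eq hB (z₀ := 0) ?_
  have hne : Tendsto (fun t : ℝ => (t : ℂ)) (𝓝[≠] 0) (𝓝[≠] 0) :=
    tendsto_nhdsWithin_of_tendsto_nhds_of_eventually_within _
      ((Complex.continuous_ofReal.tendsto' 0 0 rfl).mono_left nhdsWithin_le_nhds)
      (eventually_mem_nhdsWithin.mono fun t ht h => ht (by simpa using h))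
  exact hne.frequently (Eventually.frequently
    (Eventually.of_forall fun t => (hF.2 t).trans (hG.2 t).symm))

/-- Integer values tending to zero vanish eventually. -/
theorem exists_forall_ge_eq_zero_of_int_valued {u : ℕ → ℂ} (hu : Tendsto u atTop (𝓝 0))
    (hint : ∀ n, ∃ m : ℤ, u n = m) : ∃ N : ℕ, ∀ n, N ≤ n → u n = 0 := by
  obtain ⟨N, hN⟩ := eventually_atTop.1 (hu.norm.eventually_lt_const (show ‖(0 : ℂ)‖ < 1 by simp))
  refine ⟨N, fun n hn => ?_⟩
  obtain ⟨m, hm⟩ := hint n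
  have h1 := hN n hn
  rw [hm, Complex.norm_intCast] at h1
  have h2 : |m| < 1 := by exact_mod_cast h1
  rw [hm, Int.abs_lt_one_iff.1 h2, Int.cast_zero]

theorem proposition4 (f : ℝ → ℂ) (hcont : Continuous f)
    (hL2 : MemLp f 2 (volume : Measure ℝ)) (hband : IsBandlimited f) (hne : f ≠ 0)
    (hint : ∀ n : ℕ, ∃ m : ℤ, f (n : ℝ) = (m : ℂ)) :
    ((∃ F : ℂ → ℂ, IsEntireExtension f F) ∧
      ∀ F : ℂ → ℂ, IsEntireExtension f F →
        IsOfExponentialType F ∧ 0.8 ≤ exponentialType F) ∧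
    ¬ IsBandlimitedTo 0.8 f := by
  obtain ⟨Ω, hΩ⟩ := hband
  obtain ⟨hlim, F₀, hF₀, hΩ₀⟩ := hΩ.exists_entire_extension hcont
  have hnat : Tendsto (fun n : ℕ => f n) atTop (𝓝 0) :=
    hlim.comp (tendsto_natCast_atTop_atTop.mono_right atTop_le_cocompact)
  obtain ⟨N, hN⟩ := exists_forall_ge_eq_zero_of_int_valued hnat hint
  have hgrowth : ∀ F : ℂ → ℂ, IsEntireExtension f F → ∀ τ ∈ growthExponents F, 1 ≤ τ := by
    intro F hF τ hτ
    by_contra! hlt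
    have hzero : F = 0 := eq_zero_of_growth_lt_one_of_zeros hF.1 hτ hlt (N := N) fun n hn => by
      have := hF.2 n
      rw [hN n hn] at this
      exact_mod_cast this
    exact hne (funext fun t => by rw [← hF.2 t, hzero]; rfl)
  refine ⟨⟨⟨F₀, hF₀⟩, fun F hF => ?_⟩, fun h => ?_⟩
  · have hmem : Ω ∈ growthExponents F := hF.unique hF₀ ▸ hΩ₀
    refine ⟨⟨Ω, hmem⟩, le_csInf ⟨Ω, hmem⟩ fun τ hτ => ?_⟩
    have := hgrowth F hF τ hτ
    norm_num
    linarith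
  -- Bandlimitation to 0.8 would make 0.8 itself a growth exponent.
  · obtain ⟨-, F, hF, hmem⟩ := h.exists_entire_extension hcont
    have := hgrowth F hF _ hmem
    norm_num at this
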